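/- Let $a,b\in\mathbb{R}$ and let $P_n(z)\in\mathbb{R}[z]$, $n\ge 0$, be the polynomials generated by $$\sum_{n=0}^{\infty}P_n(z)t^n=\frac{1}{\big((az+b)t+1\big)\big(t^2+zt+1\big)}.$$ Equivalently, $P_n(z)=Q_n(-z/2)$, where $$Q_n(z)=\sum_{k=0}^{n}(2az-b)^k\,U_{n-k}(z)$$ and $U_m$ is the $m$-th Chebyshev polynomial of the second kind ($U_0=1$, $U_1=2z$, $U_{m+1}=2zU_m-U_{m-1}$). Then all complex zeros of all those polynomials $P_n$ that are not identically zero are real if and only if $|b|\le 1-2|a|$. Moreover, when $|b|\le 1-2|a|$, no $P_n$ is identically zero, all complex zeros of every $P_n$ lie in the open interval $(-2,2)$, and they are dense there as $n\to\infty$: for all real $u<v$ with $-2\le u<v\le 2$, the polynomial $P_n$ has a zero in $(u,v)$ for all sufficiently large $n$. -/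

import Mathlib

open Polynomial

noncomputable section

/-- The power series `((a z + b) t + 1) (t ^ 2 + z t + 1)` in the variable `t`, with coefficients
in the polynomial ring `ℝ[z]`. -/
def genDenom (a b : ℝ) : PowerSeries ℝ[X] :=
  (PowerSeries.C (C a * X + C b) * PowerSeries.X + 1) *
    (PowerSeries.X ^ 2 + PowerSeries.C X * PowerSeries.X + 1)

/-- The polynomial `P_n(z)`: the coefficient of `t ^ n` in the power series
`1 / (((a z + b) t + 1) (t ^ 2 + z t + 1))` over `ℝ[z]`. The denominator has constant coefficient
`1`, so its inverse is the power series inverse at the unit `1`. -/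
def genPoly (a b : ℝ) (n : ℕ) : ℝ[X] :=
  PowerSeries.coeff n (PowerSeries.invOfUnit (genDenom a b) 1)

/-- The polynomials `P_n` are indeed generated by the reciprocal of the denominator. -/
theorem genDenom_mul_mk_genPoly (a b : ℝ) :
    genDenom a b * PowerSeries.mk (genPoly a b) = 1 := by
  have h : PowerSeries.mk (genPoly a b) = PowerSeries.invOfUnit (genDenom a b) 1 := by
    ext n
    simp [genPoly]
  rw [h]
  apply PowerSeries.mul_invOfUnit
  simp [genDenom]

/-- The linear combination `Q_n(z) = ∑_{k=0}^{n} (A z + B) ^ k U_{n-k}(z)` of Chebyshev polynomials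
of the second kind. -/
def chebComb (A B : ℝ) (n : ℕ) : ℝ[X] :=
  ∑ k ∈ Finset.range (n + 1), (C A * X + C B) ^ k * Chebyshev.U ℝ ((n : ℤ) - (k : ℤ))

end

/-!
Put `A = 2a`, `B = -b`, `s = A x + B` and `Q_n = chebComb A B n`, so that `P_n (z) = Q_n (-z / 2)`;
the condition on the parameters reads `|A| + |B| ≤ 1`, that is, `|s| ≤ 1` for all `x` in `[-1, 1]`.
Summing the geometric series gives, for `x = cos θ`,
`(1 - 2 s x + s²) sin θ Q_n(x) = sin ((n+1)θ) - s sin ((n+2)θ) + s^(n+2) sin θ`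
(`mul_chebComb`, `aeval_chebComb_cos`).

*Sufficiency.* The first two terms on the right are the imaginary part of
`e^{i(n+1)θ} (1 - s e^{iθ})`. The third is smaller than the modulus of this number, since
`|1 - s e^{iθ}|² - (s sin θ)² = (1 - s cos θ)² > 0`. So `Q_n (cos θ)` has a known sign wherever the
argument of this number, the `phase`, is an odd multiple of `π/2` (`sin_phase_mul_eval_pos`). The
phase is continuous on `(0, π)` and takes all the values `π/2 + kπ` with `0 ≤ k ≤ n`
(`exists_zeros_before`), which gives `n` sign changes, hence `n = deg Q_n` zeros in `(-1, 1)`. On a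
fixed interval the growth of the phase is unbounded as `n → ∞`, which gives density
(`eventually_exists_zero`).

*Necessity.* Suppose that all zeros are real and `|A| + |B| > 1`. The functions `Q_n' / (n Q_n)`
form a normal family off the real axis, because they are means of functions `1 / (x - r)` with `r`
real; let `g` be a limit along an ultrafilter, which is holomorphic (`exists_limit_logDeriv`). For
`θ` in the half-strip `0 < re θ < π`, `0 < im θ`, the displayed formula writes `Q_n (cos θ)` as a
combination of the `n`-th powers of `e^{iθ}`, `e^{-iθ}` and `s`. Where one of them dominates, `g` is
its logarithmic derivative with respect to `x` (`tendsto_logDeriv_of_dominant`). There is an open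
set on which `s` dominates, whence `g = A / (A x + B)` on the whole half-plane by analytic
continuation; but there is also a point at which `e^{-iθ}` dominates, where `g = i / sin θ`.
Comparison gives `A e^{iθ} = -B` with `e^{iθ}` not real, so `A = B = 0`, a contradiction.
-/

/-! ### Closed forms of the polynomials -/

theorem chebComb_zero (A B : ℝ) : chebComb A B 0 = 1 := by
  simp [chebComb]

theorem chebComb_succ (A B : ℝ) (n : ℕ) :
    chebComb A B (n + 1) = (C A * X + C B) * chebComb A B n + Chebyshev.U ℝ (n + 1 : ℕ) := by
  rw [chebComb, Finset.sum_range_succ', chebComb, Finset.mul_sum]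
  congr 1
  · refine Finset.sum_congr rfl fun k _ => ?_
    rw [pow_succ', mul_assoc]
    congr 3
    push_cast
    ring
  · simp

/-- Summation of the geometric-type sum `Q_n`: a closed form with three terms, valid after
multiplication by `1 - 2 s x + s ^ 2`, where `s = A x + B`. -/
theorem mul_chebComb (A B : ℝ) (n : ℕ) :
    (1 - 2 * (C A * X + C B) * X + (C A * X + C B) ^ 2) * chebComb A B n =
      Chebyshev.U ℝ n - (C A * X + C B) * Chebyshev.U ℝ (n + 1) + (C A * X + C B) ^ (n + 2) := by
  induction n with
  | zero => simp [chebComb_zero]; ring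
  | succ n ih =>
    have h := Chebyshev.U_add_two ℝ (n : ℤ)
    rw [chebComb_succ]
    push_cast
    rw [show (n : ℤ) + 1 + 1 = n + 2 by ring, h]
    linear_combination (C A * X + C B) * ih

theorem natDegree_chebComb_le (A B : ℝ) (n : ℕ) : (chebComb A B n).natDegree ≤ n := by
  induction n with
  | zero => simp [chebComb_zero]
  | succ n ih =>
    rw [chebComb_succ]
    refine (natDegree_add_le _ _).trans (max_le ?_ ?_)
    · refine natDegree_mul_le.trans ?_
      have := natDegree_linear_le (a := A) (b := B)
      omega
    · rw [Chebyshev.natDegree_U_natCast]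

/-- The trigonometric form of `Q_n` at a complex argument `cos θ`, with denominators cleared. -/
theorem aeval_chebComb_cos (A B : ℝ) (n : ℕ) (θ : ℂ) :
    (1 - 2 * (A * Complex.cos θ + B) * Complex.cos θ + (A * Complex.cos θ + B) ^ 2) *
        Complex.sin θ * aeval (Complex.cos θ) (chebComb A B n) =
      Complex.sin ((n + 1) * θ) - (A * Complex.cos θ + B) * Complex.sin ((n + 2) * θ) +
        (A * Complex.cos θ + B) ^ (n + 2) * Complex.sin θ := by
  have h := congrArg (aeval (Complex.cos θ)) (mul_chebComb A B n)
  have h1 := Chebyshev.U_complex_cos θ n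
  have h2 := Chebyshev.U_complex_cos θ (n + 1)
  push_cast at h2
  rw [add_assoc, one_add_one_eq_two] at h2
  simp only [map_mul, map_add, map_sub, map_pow, map_one, aeval_X, aeval_C, Complex.coe_algebraMap,
    Chebyshev.aeval_U, map_ofNat] at h
  push_cast at h1
  linear_combination Complex.sin θ * h + h1 - (A * Complex.cos θ + B) * h2

/-- The trigonometric form of `Q_n` at a real argument `cos θ`, with denominators cleared. -/
theorem eval_chebComb_cos (A B : ℝ) (n : ℕ) (θ : ℝ) :
    (1 - 2 * (A * Real.cos θ + B) * Real.cos θ + (A * Real.cos θ + B) ^ 2) *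
        Real.sin θ * (chebComb A B n).eval (Real.cos θ) =
      Real.sin ((n + 1) * θ) - (A * Real.cos θ + B) * Real.sin ((n + 2) * θ) +
        (A * Real.cos θ + B) ^ (n + 2) * Real.sin θ := by
  have h := congrArg (eval (Real.cos θ)) (mul_chebComb A B n)
  have h1 := Chebyshev.U_real_cos θ n
  have h2 := Chebyshev.U_real_cos θ (n + 1)
  push_cast at h2
  rw [add_assoc, one_add_one_eq_two] at h2
  simp only [eval_mul, eval_add, eval_sub, eval_pow, eval_one, eval_X, eval_C, eval_ofNat] at h
  push_cast at h1
  linear_combination Real.sin θ * h + h1 - (A * Real.cos θ + B) * h2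

/-- The polynomials `P_n` and `Q_n` have the same generating series, after `z ↦ -z / 2`. -/
theorem genPoly_eq_chebComb_comp (a b : ℝ) (n : ℕ) :
    genPoly a b n = (chebComb (2 * a) (-b) n).comp (C (-(1 / 2) : ℝ) * X) := by
  set V : ℕ → ℝ[X] := fun m => (Chebyshev.U ℝ m).comp (C (-(1 / 2) : ℝ) * X) with hV
  set q : ℕ → ℝ[X] := fun m => (chebComb (2 * a) (-b) m).comp (C (-(1 / 2) : ℝ) * X) with hq
  have hC : C (2 : ℝ) * (C (-(1 / 2) : ℝ) * X) = -X := by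
    rw [← mul_assoc, ← C_mul]
    norm_num
  have hVrec : ∀ m : ℕ, V (m + 2) = -X * V (m + 1) - V m := by
    intro m
    simp only [hV]
    push_cast
    rw [Chebyshev.U_add_two, show (2 : ℝ[X]) = C 2 from rfl]
    simp only [sub_comp, mul_comp, X_comp, C_comp]
    rw [hC]
  have hqrec : ∀ m : ℕ, q (m + 1) = -(C a * X + C b) * q m + V (m + 1) := by
    intro m
    simp only [hq, hV]
    rw [chebComb_succ, C_mul, show C (-b) = -C b from C_neg]
    simp only [add_comp, mul_comp, X_comp, C_comp, neg_comp]
    linear_combination (C a * (chebComb (2 * a) (-b) m).comp (C (-(1 / 2)) * X)) * hC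
  have hq0 : q 0 = 1 := by simp [hq, chebComb_zero]
  have hV0 : V 0 = 1 := by simp [hV]
  have hV1 : V 1 = -X := by
    rw [← hC, show C (2 : ℝ) = 2 from rfl]
    simp [hV]
  have h1 : (PowerSeries.C (C a * X + C b) * PowerSeries.X + 1) * PowerSeries.mk q =
      PowerSeries.mk V := by
    ext1 m
    cases m with
    | zero => simp [hq0, hV0]
    | succ m =>
      rw [add_mul, one_mul, mul_assoc, map_add, PowerSeries.coeff_C_mul,
        PowerSeries.coeff_succ_X_mul]
      simp only [PowerSeries.coeff_mk, hqrec]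
      ring
  have h2 : (PowerSeries.X ^ 2 + PowerSeries.C X * PowerSeries.X + 1) * PowerSeries.mk V = 1 := by
    ext1 m
    rw [add_mul, add_mul, one_mul, mul_assoc, pow_two, mul_assoc, map_add, map_add,
      PowerSeries.coeff_C_mul]
    rcases m with _ | _ | m
    · simp [hV0]
    · simp [PowerSeries.coeff_succ_X_mul, PowerSeries.coeff_one, hV0, hV1]
    · simp only [PowerSeries.coeff_succ_X_mul, PowerSeries.coeff_mk, PowerSeries.coeff_one]
      rw [show m + 1 + 1 = m + 2 from rfl, hVrec]
      simp only [neg_mul, Nat.add_eq_zero_iff, OfNat.ofNat_ne_zero, and_false, ↓reduceIte]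
      ring
  have h3 : genDenom a b * PowerSeries.mk q = 1 := by
    rw [genDenom, mul_comm (PowerSeries.C _ * _ + 1), mul_assoc, h1, h2]
  have h4 : PowerSeries.mk (genPoly a b) = PowerSeries.mk q := by
    have h5 := genDenom_mul_mk_genPoly a b
    calc _ = (genDenom a b * PowerSeries.mk q) * PowerSeries.mk (genPoly a b) := by
          rw [h3, one_mul]
      _ = (genDenom a b * PowerSeries.mk (genPoly a b)) * PowerSeries.mk q := by ring
      _ = _ := by rw [h5, one_mul]
  have h5 := congrArg (PowerSeries.coeff n) h4
  rwa [PowerSeries.coeff_mk, PowerSeries.coeff_mk] at h5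

/-! ### Real zeros inside the parameter region -/

theorem abs_linear_le_one {A B : ℝ} (h : |A| + |B| ≤ 1) {c : ℝ} (hc : |c| ≤ 1) :
    |A * c + B| ≤ 1 := by
  calc |A * c + B| ≤ |A * c| + |B| := abs_add_le _ _
    _ ≤ |A| * 1 + |B| := by rw [abs_mul]; gcongr
    _ ≤ 1 := by linarith

theorem one_sub_mul_pos {s c : ℝ} (hs : |s| ≤ 1) (hc : |c| < 1) : 0 < 1 - s * c := by
  have h : |s * c| < 1 := by
    rw [abs_mul]
    exact (mul_le_of_le_one_left (abs_nonneg c) hs).trans_lt hc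
  linarith [(abs_lt.1 h).2]

theorem abs_cos_lt_one {θ : ℝ} (h0 : 0 < θ) (hπ : θ < Real.pi) : |Real.cos θ| < 1 := by
  have h := Real.sin_pos_of_pos_of_lt_pi h0 hπ
  rw [← sq_lt_one_iff_abs_lt_one]
  nlinarith [Real.sin_sq_add_cos_sq θ]

/-- Minus the argument of `1 - s e^{iθ}`, where `s = A cos θ + B`. -/
noncomputable def argShift (A B θ : ℝ) : ℝ :=
  Real.arctan ((A * Real.cos θ + B) * Real.sin θ / (1 - (A * Real.cos θ + B) * Real.cos θ))

/-- The argument of `e^{i(n+1)θ} (1 - s e^{iθ})`, where `s = A cos θ + B`. -/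
noncomputable def phase (A B : ℝ) (n : ℕ) (θ : ℝ) : ℝ := (n + 1) * θ - argShift A B θ

theorem continuousOn_phase {A B : ℝ} (h : |A| + |B| ≤ 1) (n : ℕ) :
    ContinuousOn (phase A B n) (Set.Ioo 0 Real.pi) := by
  unfold phase argShift
  refine ContinuousOn.sub (by fun_prop) (Real.continuous_arctan.comp_continuousOn ?_)
  refine ContinuousOn.div (by fun_prop) (by fun_prop) fun θ hθ => ?_
  have hc := abs_cos_lt_one hθ.1 hθ.2
  exact (one_sub_mul_pos (abs_linear_le_one h hc.le) hc).ne'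

/-- Where `sin (phase)` is `1` or `-1`, it determines the sign of `Q_n (cos θ)`: the remaining term
`s ^ (n + 2) sin θ` is smaller than the amplitude `|1 - s e^{iθ}|`, because
`|1 - s e^{iθ}| ^ 2 - (s sin θ) ^ 2 = (1 - s cos θ) ^ 2 > 0`. -/
theorem sin_phase_mul_eval_pos {A B : ℝ} (h : |A| + |B| ≤ 1) (n : ℕ) {θ : ℝ}
    (h0 : 0 < θ) (hπ : θ < Real.pi) (hsin : |Real.sin (phase A B n θ)| = 1) :
    0 < Real.sin (phase A B n θ) * (chebComb A B n).eval (Real.cos θ) := by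
  have hc := abs_cos_lt_one h0 hπ
  have hs := abs_linear_le_one h hc.le
  have hform := eval_chebComb_cos A B n θ
  have hsinpos := Real.sin_pos_of_pos_of_lt_pi h0 hπ
  have hp := one_sub_mul_pos hs hc
  have hsq := Real.sin_sq_add_cos_sq θ
  have hphase : phase A B n θ = (n + 1) * θ - Real.arctan ((A * Real.cos θ + B) * Real.sin θ /
    (1 - (A * Real.cos θ + B) * Real.cos θ)) := rfl
  set s := A * Real.cos θ + B
  set p := 1 - s * Real.cos θ with hpdef
  set r := s * Real.sin θ with hr
  set R := p * √(1 + (r / p) ^ 2) with hR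
  have hroot : 0 < √(1 + (r / p) ^ 2) := by positivity
  have hRpos : 0 < R := by positivity
  have hRsq : R ^ 2 = p ^ 2 + r ^ 2 := by
    rw [hR, mul_pow, Real.sq_sqrt (by positivity)]
    field_simp
  have hcosφ : R * Real.cos (Real.arctan (r / p)) = p := by
    rw [Real.cos_arctan, hR]
    field_simp
  have hsinφ : R * Real.sin (Real.arctan (r / p)) = r := by
    rw [Real.sin_arctan, hR]
    field_simp
  have hmain : Real.sin ((n + 1) * θ) - s * Real.sin ((n + 2) * θ) =
      R * Real.sin (phase A B n θ) := by
    rw [hphase, Real.sin_sub, show ((n : ℝ) + 2) * θ = (n + 1) * θ + θ by ring, Real.sin_add]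
    linear_combination -Real.sin ((n + 1) * θ) * hcosφ + Real.cos ((n + 1) * θ) * hsinφ
      + Real.sin ((n + 1) * θ) * hpdef + Real.cos ((n + 1) * θ) * hr
  rw [hmain] at hform
  have herr : |s ^ (n + 2) * Real.sin θ| < R := by
    refine lt_of_le_of_lt ?_ (abs_lt_of_sq_lt_sq (a := r) (by nlinarith) hRpos.le)
    rw [hr, abs_mul, abs_mul, abs_pow]
    gcongr
    exact pow_le_of_le_one (abs_nonneg s) hs (by omega)
  have hD : 0 < 1 - 2 * s * Real.cos θ + s ^ 2 := by nlinarith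
  have hσ : Real.sin (phase A B n θ) * Real.sin (phase A B n θ) = 1 := by
    rw [← abs_mul_abs_self, hsin, one_mul]
  have hσe : -R < Real.sin (phase A B n θ) * (s ^ (n + 2) * Real.sin θ) := by
    refine (abs_lt.1 ?_).1
    rwa [abs_mul, hsin, one_mul]
  set σ := Real.sin (phase A B n θ)
  have hprod : 0 < ((1 - 2 * s * Real.cos θ + s ^ 2) * Real.sin θ) *
      (σ * (chebComb A B n).eval (Real.cos θ)) := by
    have : ((1 - 2 * s * Real.cos θ + s ^ 2) * Real.sin θ) *
        (σ * (chebComb A B n).eval (Real.cos θ)) = R + σ * (s ^ (n + 2) * Real.sin θ) := by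
      linear_combination σ * hform + R * hσ
    linarith
  exact pos_of_mul_pos_right hprod (by positivity)

theorem exists_zero_Ioo {f : ℝ → ℝ} (hf : Continuous f) {x y : ℝ} (hxy : x < y)
    (h : f x * f y < 0) : ∃ z ∈ Set.Ioo x y, f z = 0 := by
  rcases mul_neg_iff.1 h with ⟨hx, hy⟩ | ⟨hx, hy⟩
  · exact intermediate_value_Ioo' hxy.le hf.continuousOn ⟨hy, hx⟩
  · exact intermediate_value_Ioo hxy.le hf.continuousOn ⟨hx, hy⟩

theorem continuous_eval_cos (p : ℝ[X]) : Continuous fun θ : ℝ => p.eval (Real.cos θ) :=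
  p.continuous.comp Real.continuous_cos

/-- Between two points at which the sine of the phase is `1` and `-1`, in either order, there is a
zero of `Q_n (cos θ)`. -/
theorem exists_zero_of_sin_phase {A B : ℝ} (h : |A| + |B| ≤ 1) (n : ℕ) {x y : ℝ} (hx : 0 < x)
    (hxy : x < y) (hy : y < Real.pi) (hsin : |Real.sin (phase A B n x)| = 1)
    (hneg : Real.sin (phase A B n y) = -Real.sin (phase A B n x)) :
    ∃ θ ∈ Set.Ioo x y, (chebComb A B n).eval (Real.cos θ) = 0 := by
  refine exists_zero_Ioo (continuous_eval_cos _) hxy ?_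
  have h1 := sin_phase_mul_eval_pos h n hx (hxy.trans hy) hsin
  have h2 := sin_phase_mul_eval_pos h n (hx.trans hxy) hy (by rw [hneg, abs_neg, hsin])
  rw [hneg] at h2
  have h3 := mul_pos h1 h2
  have hσ : Real.sin (phase A B n x) * Real.sin (phase A B n x) = 1 := by
    rw [← abs_mul_abs_self, hsin, one_mul]
  set σ := Real.sin (phase A B n x)
  set e := (chebComb A B n).eval (Real.cos x)
  set e' := (chebComb A B n).eval (Real.cos y)
  have : σ * e * (-σ * e') = -(e * e') := by linear_combination (-e * e') * hσ
  change e * e' < 0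
  linarith

theorem arctan_le_of_le {x y : ℝ} (hy : 0 ≤ y) (h : x ≤ y) : Real.arctan x ≤ y := by
  refine (Real.arctan_strictMono.monotone h).trans ?_
  simpa using Real.le_tan (Real.arctan_nonneg.2 hy) (Real.arctan_lt_pi_div_two y)

/-- Near `θ = 0` the argument shift is at least `-θ`. -/
theorem neg_le_argShift {A B : ℝ} (h : |A| + |B| ≤ 1) {θ : ℝ} (h0 : 0 < θ)
    (hπ : θ ≤ Real.pi / 2) : -θ ≤ argShift A B θ := by
  have hc := abs_cos_lt_one h0 (by linarith [Real.pi_pos])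
  have hs := abs_linear_le_one h hc.le
  have hp := one_sub_mul_pos hs hc
  have hcos : 0 ≤ Real.cos θ := Real.cos_nonneg_of_neg_pi_div_two_le_of_le (by linarith) hπ
  have hsinpos := Real.sin_pos_of_pos_of_lt_pi h0 (by linarith [Real.pi_pos])
  have hle := Real.sin_le h0.le
  rw [neg_le, argShift, ← Real.arctan_neg]
  set s := A * Real.cos θ + B
  refine arctan_le_of_le h0.le ?_
  rw [← neg_div, div_le_iff₀ hp]
  rcases le_total 0 s with h1 | h1
  · nlinarith [mul_nonneg h1 hsinpos.le, mul_nonneg h0.le hp.le]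
  · nlinarith [mul_nonneg (mul_nonneg (neg_nonneg.2 h1) hcos) h0.le, (abs_le.1 hs).1]

/-- Near `θ = π` the argument shift is at most `π - θ`. -/
theorem argShift_le {A B : ℝ} (h : |A| + |B| ≤ 1) {θ : ℝ} (h0 : Real.pi / 2 ≤ θ)
    (hπ : θ < Real.pi) : argShift A B θ ≤ Real.pi - θ := by
  have key := neg_le_argShift (A := A) (B := -B) (by rwa [abs_neg]) (θ := Real.pi - θ)
    (by linarith) (by linarith)
  have heq : argShift A (-B) (Real.pi - θ) = -argShift A B θ := by
    rw [argShift, argShift, Real.cos_pi_sub, Real.sin_pi_sub, ← Real.arctan_neg]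
    congr 1
    rw [← neg_div]
    congr 1 <;> ring
  linarith

/-- The phase attains the values `π/2, 3π/2, …, π/2 + kπ` at increasing points; the sign changes of
`Q_n (cos θ)` between them give `k` zeros. -/
theorem exists_zeros_before {A B : ℝ} (h : |A| + |B| ≤ 1) (n k : ℕ) (hk : k ≤ n) :
    ∃ θ : ℝ, 0 < θ ∧ θ ≤ Real.pi - Real.pi / (2 * (n + 2)) ∧
      phase A B n θ = Real.pi / 2 + k * Real.pi ∧
      ∃ S : Finset ℝ, S.card = k ∧
        ∀ x ∈ S, x ∈ Set.Ioo 0 θ ∧ (chebComb A B n).eval (Real.cos x) = 0 := by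
  have hπ := Real.pi_pos
  set δ := Real.pi / (2 * ((n : ℝ) + 2)) with hδ
  have hδpos : 0 < δ := by positivity
  have hδmul : (n + 2) * δ = Real.pi / 2 := by
    rw [hδ]
    field_simp
  have hδle : 2 * δ ≤ Real.pi / 2 := by
    rw [← hδmul]
    gcongr
    linarith [Nat.cast_nonneg (α := ℝ) n]
  have hend : Real.pi / 2 + n * Real.pi ≤ phase A B n (Real.pi - δ) := by
    have := argShift_le h (θ := Real.pi - δ) (by linarith) (by linarith)
    rw [phase]
    nlinarith
  induction k with
  | zero =>
    have hstart : phase A B n δ ≤ Real.pi / 2 := by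
      have := neg_le_argShift h hδpos (by linarith)
      rw [phase]
      nlinarith
    obtain ⟨θ, hθ, hval⟩ := intermediate_value_Icc (a := δ) (b := Real.pi - δ) (by linarith)
      ((continuousOn_phase h n).mono fun x hx => ⟨by linarith [hx.1], by linarith [hx.2]⟩)
      ⟨hstart, le_trans (by nlinarith [Nat.cast_nonneg (α := ℝ) n]) hend⟩
    exact ⟨θ, by linarith [hθ.1], hθ.2, by simpa using hval, ∅, by simp⟩
  | succ k ih =>
    obtain ⟨θ, hθ0, hθ1, hval, S, hcard, hS⟩ := ih (by omega)
    have hkn : ((k + 1 : ℕ) : ℝ) ≤ n := by exact_mod_cast hk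
    obtain ⟨θ', hθ', hval'⟩ := intermediate_value_Icc (a := θ) (b := Real.pi - δ) hθ1
      ((continuousOn_phase h n).mono fun x hx => ⟨by linarith [hx.1], by linarith [hx.2]⟩)
      (show Real.pi / 2 + (k + 1 : ℕ) * Real.pi ∈ _ from
        ⟨by rw [hval]; push_cast; linarith,
          le_trans (by nlinarith) hend⟩)
    have hlt : θ < θ' := by
      refine lt_of_le_of_ne hθ'.1 fun hne => ?_
      rw [← hne, hval] at hval'
      push_cast at hval'
      linarith
    obtain ⟨z, hz, hz0⟩ := exists_zero_of_sin_phase h n hθ0 hlt (by linarith [hθ'.2])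
      (by rw [hval, Real.sin_add_nat_mul_pi]; simp)
      (by
        rw [hval, hval', Real.sin_add_nat_mul_pi, Real.sin_add_nat_mul_pi, pow_succ]
        ring)
    have hzS : z ∉ S := fun hzS => (hS z hzS).1.2.not_gt hz.1
    refine ⟨θ', hθ0.trans hlt, hθ'.2, hval', insert z S, ?_, ?_⟩
    · rw [Finset.card_insert_of_notMem hzS, hcard]
    · intro x hx
      rcases Finset.mem_insert.1 hx with rfl | hx
      · exact ⟨⟨hθ0.trans hz.1, hz.2⟩, hz0⟩
      · exact ⟨⟨(hS x hx).1.1, (hS x hx).1.2.trans hlt⟩, (hS x hx).2⟩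

theorem chebComb_ne_zero {A B : ℝ} (h : |A| + |B| ≤ 1) (n : ℕ) : chebComb A B n ≠ 0 := by
  obtain ⟨θ, h0, h1, hval, -⟩ := exists_zeros_before h n 0 (Nat.zero_le n)
  intro hzero
  have hδ : 0 < Real.pi / (2 * ((n : ℝ) + 2)) := by
    have := Real.pi_pos
    positivity
  have := sin_phase_mul_eval_pos h n h0 (by linarith) (by simp [hval])
  simp [hzero] at this

/-- Since `Q_n` has degree at most `n`, the `n` zeros found in `(-1, 1)` are all its zeros. -/
theorem exists_eq_ofReal_of_mem_rootSet_chebComb {A B : ℝ} (h : |A| + |B| ≤ 1) (n : ℕ) {z : ℂ}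
    (hz : z ∈ (chebComb A B n).rootSet ℂ) : ∃ x ∈ Set.Ioo (-1 : ℝ) 1, (x : ℂ) = z := by
  obtain ⟨θ, h0, h1, -, S, hcard, hS⟩ := exists_zeros_before h n n le_rfl
  have hδ : 0 < Real.pi / (2 * ((n : ℝ) + 2)) := by
    have := Real.pi_pos
    positivity
  have hSπ : ∀ x ∈ S, 0 < x ∧ x < Real.pi := fun x hx =>
    ⟨(hS x hx).1.1, (hS x hx).1.2.trans (by linarith)⟩
  have hne := chebComb_ne_zero h n
  set f : ℝ → ℂ := fun x => (Real.cos x : ℂ) with hf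
  have hinj : Set.InjOn f S := by
    intro x hx y hy hxy
    exact Real.injOn_cos ⟨(hSπ x hx).1.le, (hSπ x hx).2.le⟩ ⟨(hSπ y hy).1.le, (hSπ y hy).2.le⟩
      (Complex.ofReal_injective hxy)
  have hsub : S.image f ⊆ ((chebComb A B n).aroots ℂ).toFinset := by
    intro w hw
    obtain ⟨x, hx, rfl⟩ := Finset.mem_image.1 hw
    rw [Multiset.mem_toFinset, mem_aroots]
    refine ⟨hne, ?_⟩
    have := aeval_algebraMap_apply ℂ (Real.cos x) (chebComb A B n)
    rw [Complex.coe_algebraMap] at this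
    rw [hf, this, coe_aeval_eq_eval, (hS x hx).2, Complex.ofReal_zero]
  have hcardle : ((chebComb A B n).aroots ℂ).toFinset.card ≤ (S.image f).card := by
    rw [Finset.card_image_of_injOn hinj, hcard]
    refine (Multiset.toFinset_card_le _).trans ((card_roots' _).trans ?_)
    exact natDegree_map_le.trans (natDegree_chebComb_le A B n)
  have heq := Finset.eq_of_subset_of_card_le hsub hcardle
  have hzmem : z ∈ S.image f := by
    rw [heq, Multiset.mem_toFinset]
    exact (mem_aroots.2 (mem_rootSet.1 hz))
  obtain ⟨x, hx, rfl⟩ := Finset.mem_image.1 hzmem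
  exact ⟨Real.cos x, abs_lt.1 (abs_cos_lt_one (hSπ x hx).1 (hSπ x hx).2), rfl⟩

/-- The phase increases by more than `3π` along a fixed interval once `n` is large, so that it
passes through consecutive points of `π/2 + πℤ`. -/
theorem eventually_exists_zero {A B : ℝ} (h : |A| + |B| ≤ 1) {α β : ℝ} (hα : 0 ≤ α) (hαβ : α < β)
    (hβ : β ≤ Real.pi) :
    ∀ᶠ n : ℕ in Filter.atTop, ∃ θ ∈ Set.Ioo α β, (chebComb A B n).eval (Real.cos θ) = 0 := by
  have hπ := Real.pi_pos
  set x := (2 * α + β) / 3 with hx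
  set y := (α + 2 * β) / 3 with hy
  have hxy : 0 < y - x := by rw [hx, hy]; linarith
  filter_upwards [Filter.eventually_ge_atTop ⌈4 * Real.pi / (y - x)⌉₊] with n hn
  have hn' : 4 * Real.pi ≤ n * (y - x) := by
    rw [← div_le_iff₀ hxy]
    exact (Nat.le_ceil _).trans (by exact_mod_cast hn)
  have hgrow : phase A B n x + 3 * Real.pi ≤ phase A B n y := by
    have h1 := Real.neg_pi_div_two_lt_arctan ((A * Real.cos x + B) * Real.sin x /
      (1 - (A * Real.cos x + B) * Real.cos x))
    have h2 := Real.arctan_lt_pi_div_two ((A * Real.cos y + B) * Real.sin y /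
      (1 - (A * Real.cos y + B) * Real.cos y))
    rw [phase, phase, argShift, argShift]
    linarith
  have hcont : ContinuousOn (phase A B n) (Set.Icc x y) :=
    (continuousOn_phase h n).mono fun t ht => ⟨by linarith [ht.1], by linarith [ht.2]⟩
  set m : ℤ := ⌈(phase A B n x - Real.pi / 2) / (2 * Real.pi)⌉ with hm
  have hm1 : phase A B n x - Real.pi / 2 ≤ m * (2 * Real.pi) := by
    rw [← div_le_iff₀ (by positivity)]
    exact Int.le_ceil _
  have hm2 : m * (2 * Real.pi) < phase A B n x - Real.pi / 2 + 2 * Real.pi := by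
    have := Int.ceil_lt_add_one ((phase A B n x - Real.pi / 2) / (2 * Real.pi))
    rw [← hm, ← sub_lt_iff_lt_add, lt_div_iff₀ (by positivity)] at this
    linarith
  obtain ⟨t, ht, htv⟩ := intermediate_value_Icc (by linarith) hcont
    (show Real.pi / 2 + m * (2 * Real.pi) ∈ _ from ⟨by linarith, by linarith⟩)
  obtain ⟨t', ht', htv'⟩ := intermediate_value_Icc ht.2
    (hcont.mono (Set.Icc_subset_Icc_left ht.1))
    (show Real.pi / 2 + m * (2 * Real.pi) + Real.pi ∈ _ from ⟨by linarith, by linarith⟩)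
  have hlt : t < t' := by
    refine lt_of_le_of_ne ht'.1 fun hne => ?_
    rw [← hne, htv] at htv'
    linarith
  obtain ⟨z, hz, hz0⟩ := exists_zero_of_sin_phase h n (by linarith [ht.1]) hlt
    (by linarith [ht'.2]) (by rw [htv, Real.sin_add_int_mul_two_pi]; simp)
    (by rw [htv, htv', Real.sin_add_pi])
  exact ⟨z, ⟨by linarith [hz.1, ht.1], by linarith [hz.2, ht'.2]⟩, hz0⟩

/-! ### Limits of logarithmic derivatives of real-rooted polynomials -/

theorem exists_tendsto_hyperfilter {u : ℕ → ℂ} {M : ℝ} (h : ∀ n, ‖u n‖ ≤ M) :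
    ∃ l, Filter.Tendsto u (Filter.hyperfilter ℕ) (nhds l) := by
  obtain ⟨l, -, hl⟩ := (isCompact_closedBall (0 : ℂ) M).ultrafilter_le_nhds
    ((Filter.hyperfilter ℕ).map u)
    (Filter.tendsto_principal.2 (Filter.Eventually.of_forall fun n => by simpa using h n))
  exact ⟨l, hl⟩

theorem norm_sum_map_div_le {m : Multiset ℂ} {n : ℕ} (hm : m.card ≤ n) {f : ℂ → ℂ} {M : ℝ}
    (hM : 0 ≤ M) (hf : ∀ r ∈ m, ‖f r‖ ≤ M) : ‖(m.map f).sum / n‖ ≤ M := by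
  have h1 : ‖(m.map f).sum‖ ≤ n * M := by
    refine (norm_multiset_sum_le _).trans ?_
    refine (Multiset.sum_le_card_nsmul _ M ?_).trans ?_
    · intro x hx
      rw [Multiset.map_map, Multiset.mem_map] at hx
      obtain ⟨r, hr, rfl⟩ := hx
      exact hf r hr
    · rw [nsmul_eq_mul, Multiset.card_map, Multiset.card_map]
      gcongr
  rw [norm_div, Complex.norm_natCast]
  exact div_le_of_le_mul₀ (Nat.cast_nonneg n) hM (by linarith)

/-- If the polynomials `p n` have degree at most `n` and only real zeros, then the functions
`p n' / (n p n) = n⁻¹ ∑ 1 / (z - r)` are bounded by `1 / |im z|`, together with their difference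
quotients. Their pointwise limits along an ultrafilter are therefore holomorphic off the real axis.
This replaces an appeal to Montel's theorem. -/
theorem exists_limit_logDeriv (p : ℕ → ℂ[X]) (hdeg : ∀ n, (p n).natDegree ≤ n)
    (hroot : ∀ n, ∀ r ∈ (p n).roots, r.im = 0) :
    ∃ g : ℂ → ℂ, (∀ z, z.im < 0 → DifferentiableAt ℂ g z) ∧ ∀ z, z.im < 0 → ∀ l,
      Filter.Tendsto (fun n : ℕ => (p n).derivative.eval z / (n * (p n).eval z)) Filter.atTop
        (nhds l) → g z = l := by
  have hcard : ∀ n, (p n).roots.card ≤ n := fun n => (card_roots' _).trans (hdeg n)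
  have him : ∀ n, ∀ r ∈ (p n).roots, ∀ z : ℂ, |z.im| ≤ ‖z - r‖ := fun n r hr z => by
    simpa [hroot n r hr] using Complex.abs_im_le_norm (z - r)
  have hne : ∀ n, ∀ r ∈ (p n).roots, ∀ z : ℂ, z.im < 0 → z - r ≠ 0 := fun n r hr z hz h0 => by
    have := him n r hr z
    rw [h0, norm_zero] at this
    exact (abs_pos.2 hz.ne).not_ge this
  set L : ℕ → ℂ → ℂ := fun n z => ((p n).roots.map fun r => 1 / (z - r)).sum / n with hL
  set K : ℕ → ℂ → ℂ := fun n z => ((p n).roots.map fun r => 1 / (z - r) ^ 2).sum / n with hK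
  have hLlim : ∀ z : ℂ, z.im < 0 →
      ∃ l, Filter.Tendsto (fun n => L n z) (Filter.hyperfilter ℕ) (nhds l) := fun z hz => by
    refine exists_tendsto_hyperfilter (M := 1 / |z.im|) fun n => ?_
    refine norm_sum_map_div_le (hcard n) (by positivity) fun r hr => ?_
    rw [norm_div, norm_one]
    exact one_div_le_one_div_of_le (abs_pos.2 hz.ne) (him n r hr z)
  have hKlim : ∀ z : ℂ, z.im < 0 →
      ∃ l, Filter.Tendsto (fun n => K n z) (Filter.hyperfilter ℕ) (nhds l) := fun z hz => by
    refine exists_tendsto_hyperfilter (M := 1 / |z.im| ^ 2) fun n => ?_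
    refine norm_sum_map_div_le (hcard n) (by positivity) fun r hr => ?_
    rw [norm_div, norm_one, norm_pow]
    have := abs_pos.2 hz.ne
    exact one_div_le_one_div_of_le (by positivity) (by gcongr; exact him n r hr z)
  choose! g hg using hLlim
  choose! k hk using hKlim
  refine ⟨g, fun z hz => ?_, fun z hz l hl => ?_⟩
  · have hnear : ∀ᶠ y : ℂ in nhds z, y.im < z.im / 2 :=
      Complex.continuous_im.continuousAt.eventually_lt continuousAt_const (by linarith)
    have hder : HasDerivAt g (-k z) z := by
      rw [hasDerivAt_iff_isLittleO]
      refine Asymptotics.IsBigO.trans_isLittleO ?_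
        (Asymptotics.isLittleO_pow_sub_sub z one_lt_two)
      refine Asymptotics.IsBigO.of_bound (1 / ((|z.im| / 2) * |z.im| ^ 2)) ?_
      filter_upwards [hnear] with y hy
      have hy0 : y.im < 0 := by linarith
      have hlim := (((hg y hy0).sub (hg z hz)).sub ((hk z hz).neg.const_smul (y - z))).norm
      refine le_of_tendsto hlim (Filter.Eventually.of_forall fun n => ?_)
      have hsum : L n y - L n z - (y - z) • -K n z =
          ((p n).roots.map fun r => (y - z) ^ 2 / ((y - r) * (z - r) ^ 2)).sum / n := by
        rw [hL, hK]
        simp only [smul_eq_mul]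
        rw [show ((p n).roots.map fun r => (y - z) ^ 2 / ((y - r) * (z - r) ^ 2)) =
          ((p n).roots.map fun r => 1 / (y - r) - 1 / (z - r) + (y - z) * (1 / (z - r) ^ 2)) from
          Multiset.map_congr rfl fun r hr => by
            have h1 := hne n r hr y hy0
            have h2 := hne n r hr z hz
            field_simp
            ring]
        rw [Multiset.sum_map_add, Multiset.sum_map_sub, Multiset.sum_map_mul_left]
        ring
      rw [hsum]
      refine norm_sum_map_div_le (hcard n) (by positivity) fun r hr => ?_
      have h1 := him n r hr y
      have h2 := him n r hr z
      have h3 : |z.im| / 2 ≤ |y.im| := by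
        rw [abs_of_neg hz, abs_of_neg hy0]
        linarith
      have h4 := abs_pos.2 hz.ne
      simp only [norm_div, norm_mul, norm_pow, norm_norm]
      rw [div_eq_mul_inv, ← one_div, mul_comm]
      gcongr
      exact h3.trans h1
    exact hder.differentiableAt
  · refine tendsto_nhds_unique (hg z hz) ?_
    refine (hl.mono_left Nat.hyperfilter_le_atTop).congr fun n => ?_
    simp only [hL]
    by_cases hp : p n = 0
    · simp [hp]
    have hpz : (p n).eval z ≠ 0 := fun h0 => by
      have := hroot n z ((mem_roots hp).2 h0)
      exact hz.ne this
    rw [mul_comm (n : ℂ), ← div_div,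
      (IsAlgClosed.splits (p n)).eval_derivative_div_eval_of_ne_zero hpz]

/-! ### Sums of powers with a dominant base -/

/-- The logarithmic derivative of `q n = K⁻¹ ∑ α j * h j ^ n`, divided by `n`, tends to that of the
dominant base `h j₀`. -/
theorem tendsto_logDeriv_of_dominant {ι : Type*} [Fintype ι] {α h : ι → ℂ → ℂ} {K : ℂ → ℂ}
    {q : ℕ → ℂ → ℂ} {z : ℂ} (j₀ : ι) (hα : ∀ j, DifferentiableAt ℂ (α j) z)
    (hh : ∀ j, DifferentiableAt ℂ (h j) z) (hK : DifferentiableAt ℂ K z)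
    (hq : ∀ n, DifferentiableAt ℂ (q n) z)
    (hsum : ∀ n y, K y * q n y = ∑ j, α j y * h j y ^ n)
    (hdom : ∀ j, j ≠ j₀ → ‖h j z‖ < ‖h j₀ z‖) (hα0 : α j₀ z ≠ 0) (hh0 : h j₀ z ≠ 0)
    (hK0 : K z ≠ 0) :
    Filter.Tendsto (fun n : ℕ => deriv (q n) z / (n * q n z)) Filter.atTop
      (nhds (deriv (h j₀) z / h j₀ z)) := by
  classical
  set H := h j₀ z with hH
  have hpow : ∀ j, Filter.Tendsto (fun n : ℕ => (h j z / H) ^ n) Filter.atTop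
      (nhds (if j = j₀ then 1 else 0)) := by
    intro j
    split_ifs with hj
    · subst hj
      simp [← hH, div_self hh0]
    · refine tendsto_pow_atTop_nhds_zero_of_norm_lt_one ?_
      rw [norm_div, div_lt_one (norm_pos_iff.2 hh0)]
      exact hdom j hj
  have hcast : Filter.Tendsto (fun n : ℕ => (1 : ℂ) / ((n : ℂ) + 1)) Filter.atTop (nhds 0) :=
    tendsto_one_div_add_atTop_nhds_zero_nat
  have hE : Filter.Tendsto (fun n : ℕ => K z * q (n + 1) z / H ^ n) Filter.atTop
      (nhds (α j₀ z * H)) := by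
    have h1 : Filter.Tendsto (fun n : ℕ => ∑ j, α j z * h j z * (h j z / H) ^ n) Filter.atTop
        (nhds (∑ j, α j z * h j z * (if j = j₀ then 1 else 0))) :=
      tendsto_finsetSum _ fun j _ => (hpow j).const_mul _
    simp only [mul_ite, mul_one, mul_zero, Finset.sum_ite_eq', Finset.mem_univ, if_true] at h1
    refine h1.congr fun n => ?_
    rw [hsum, Finset.sum_div]
    refine Finset.sum_congr rfl fun j _ => ?_
    rw [div_pow]
    ring
  have hderiv : ∀ n : ℕ, deriv K z * q (n + 1) z + K z * deriv (q (n + 1)) z =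
      ∑ j, (deriv (α j) z * h j z ^ (n + 1) +
        α j z * ((n + 1) * h j z ^ n * deriv (h j) z)) := by
    intro n
    have h1 : HasDerivAt (fun y => K y * q (n + 1) y)
        (deriv K z * q (n + 1) z + K z * deriv (q (n + 1)) z) z :=
      hK.hasDerivAt.mul (hq (n + 1)).hasDerivAt
    have h2 : HasDerivAt (fun y => ∑ j, α j y * h j y ^ (n + 1))
        (∑ j, (deriv (α j) z * h j z ^ (n + 1) +
          α j z * ((n + 1) * h j z ^ n * deriv (h j) z))) z := by
      refine HasDerivAt.fun_sum fun j _ => ?_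
      have h3 : HasDerivAt (fun y => α j y * h j y ^ (n + 1)) _ z :=
        (hα j).hasDerivAt.mul ((hh j).hasDerivAt.pow (n + 1))
      exact h3.congr_deriv (by simp)
    rw [show (fun y => ∑ j, α j y * h j y ^ (n + 1)) = fun y => K y * q (n + 1) y from
      funext fun y => (hsum (n + 1) y).symm] at h2
    exact h1.unique h2
  have hE' : Filter.Tendsto (fun n : ℕ => (deriv K z * q (n + 1) z + K z * deriv (q (n + 1)) z) /
      ((n + 1) * H ^ n)) Filter.atTop (nhds (α j₀ z * deriv (h j₀) z)) := by
    have h1 : Filter.Tendsto (fun n : ℕ => ∑ j, (deriv (α j) z * h j z * (1 / ((n : ℂ) + 1)) +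
          α j z * deriv (h j) z) * (h j z / H) ^ n) Filter.atTop
        (nhds (∑ j, (deriv (α j) z * h j z * 0 + α j z * deriv (h j) z) *
          (if j = j₀ then 1 else 0))) :=
      tendsto_finsetSum _ fun j _ => ((hcast.const_mul _).add_const _).mul (hpow j)
    simp only [mul_ite, mul_one, mul_zero, zero_add, Finset.sum_ite_eq', Finset.mem_univ,
      if_true] at h1
    refine h1.congr fun n => ?_
    rw [hderiv, Finset.sum_div]
    refine Finset.sum_congr rfl fun j _ => ?_
    have hn : (n : ℂ) + 1 ≠ 0 := Nat.cast_add_one_ne_zero n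
    rw [div_pow]
    field_simp
    ring
  have hne : α j₀ z * H ≠ 0 := mul_ne_zero hα0 hh0
  refine (Filter.tendsto_add_atTop_iff_nat 1).1 ?_
  have hlim := (hE'.div hE hne).sub (hcast.const_mul (deriv K z / K z))
  rw [mul_div_mul_left _ _ hα0, mul_zero, sub_zero] at hlim
  refine hlim.congr' ?_
  filter_upwards [hE.eventually_ne hne] with n hn
  have hq0 : q (n + 1) z ≠ 0 := fun h0 => hn (by rw [h0]; simp)
  have hn1 : (n : ℂ) + 1 ≠ 0 := Nat.cast_add_one_ne_zero n
  simp only [Pi.div_apply]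
  push_cast
  field_simp
  ring

/-! ### Nonreal zeros outside the parameter region -/

/-- For `K = (1 - 2 s cos θ + s ^ 2) sin θ`, the function `K Q_n (cos θ)` is a combination of the
`n`-th powers of `e^{iθ}`, `e^{-iθ}` and `s = A cos θ + B`; here are the coefficients. -/
noncomputable def trigCoeff (A B : ℝ) : Fin 3 → ℂ → ℂ :=
  ![fun θ => (Complex.exp (Complex.I * θ) -
      (A * Complex.cos θ + B) * Complex.exp (Complex.I * θ) ^ 2) / (2 * Complex.I),
    fun θ => -(Complex.exp (-(Complex.I * θ)) -
      (A * Complex.cos θ + B) * Complex.exp (-(Complex.I * θ)) ^ 2) / (2 * Complex.I),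
    fun θ => (A * Complex.cos θ + B) ^ 2 * Complex.sin θ]

/-- The three bases `e^{iθ}`, `e^{-iθ}` and `A cos θ + B` of the powers that make up
`Q_n (cos θ)`. -/
noncomputable def trigBase (A B : ℝ) : Fin 3 → ℂ → ℂ :=
  ![fun θ => Complex.exp (Complex.I * θ), fun θ => Complex.exp (-(Complex.I * θ)),
    fun θ => A * Complex.cos θ + B]

theorem sin_eq_exp_pow (m : ℕ) (θ : ℂ) : Complex.sin (m * θ) =
    (Complex.exp (Complex.I * θ) ^ m - Complex.exp (-(Complex.I * θ)) ^ m) / (2 * Complex.I) := by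
  rw [← Complex.exp_nat_mul, ← Complex.exp_nat_mul, Complex.sin, mul_comm 2 Complex.I, ← div_div,
    Complex.div_I]
  rw [show -((m : ℂ) * θ) * Complex.I = m * -(Complex.I * θ) by ring,
    show (m : ℂ) * θ * Complex.I = m * (Complex.I * θ) by ring]
  ring

theorem mul_aeval_chebComb_cos_eq_sum (A B : ℝ) (n : ℕ) (θ : ℂ) :
    (1 - 2 * (A * Complex.cos θ + B) * Complex.cos θ + (A * Complex.cos θ + B) ^ 2) *
        Complex.sin θ * aeval (Complex.cos θ) (chebComb A B n) =
      ∑ j, trigCoeff A B j θ * trigBase A B j θ ^ n := by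
  have h1 := sin_eq_exp_pow (n + 1) θ
  have h2 := sin_eq_exp_pow (n + 2) θ
  push_cast at h1 h2
  rw [aeval_chebComb_cos, h1, h2, Fin.sum_univ_three]
  simp only [trigCoeff, trigBase, Matrix.cons_val_zero, Matrix.cons_val_one, Matrix.cons_val]
  ring

theorem exp_mul_exp_neg (θ : ℂ) :
    Complex.exp (Complex.I * θ) * Complex.exp (-(Complex.I * θ)) = 1 := by
  rw [← Complex.exp_add, add_neg_cancel, Complex.exp_zero]

theorem exp_add_exp_neg (θ : ℂ) :
    Complex.exp (Complex.I * θ) + Complex.exp (-(Complex.I * θ)) = 2 * Complex.cos θ := by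
  rw [Complex.two_cos, mul_comm Complex.I, neg_mul]

theorem norm_exp_I_mul (θ : ℂ) : ‖Complex.exp (Complex.I * θ)‖ = Real.exp (-θ.im) := by
  rw [Complex.norm_exp]
  simp

theorem norm_exp_neg_I_mul (θ : ℂ) : ‖Complex.exp (-(Complex.I * θ))‖ = Real.exp θ.im := by
  rw [Complex.norm_exp]
  simp

/-- The limit of `Q_n' / (n Q_n)` at `cos θ`, where one of the three bases dominates. -/
theorem tendsto_logDeriv_chebComb {A B : ℝ} {θ : ℂ} (j₀ : Fin 3)
    (hdom : ∀ j, j ≠ j₀ → ‖trigBase A B j θ‖ < ‖trigBase A B j₀ θ‖)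
    (hα0 : trigCoeff A B j₀ θ ≠ 0) (hh0 : trigBase A B j₀ θ ≠ 0)
    (hK : 1 - 2 * (A * Complex.cos θ + B) * Complex.cos θ + (A * Complex.cos θ + B) ^ 2 ≠ 0)
    (hsin : Complex.sin θ ≠ 0) :
    Filter.Tendsto (fun n : ℕ =>
      ((chebComb A B n).map (algebraMap ℝ ℂ)).derivative.eval (Complex.cos θ) /
        (n * ((chebComb A B n).map (algebraMap ℝ ℂ)).eval (Complex.cos θ))) Filter.atTop
      (nhds (deriv (trigBase A B j₀) θ / trigBase A B j₀ θ / -Complex.sin θ)) := by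
  set p : ℕ → ℂ[X] := fun n => (chebComb A B n).map (algebraMap ℝ ℂ) with hp
  have hq : ∀ n, HasDerivAt (fun y => (p n).eval (Complex.cos y))
      ((p n).derivative.eval (Complex.cos θ) * -Complex.sin θ) θ := fun n =>
    ((p n).hasDerivAt (Complex.cos θ)).comp θ (Complex.hasDerivAt_cos θ)
  have hlim := tendsto_logDeriv_of_dominant (α := trigCoeff A B) (h := trigBase A B)
    (K := fun θ => (1 - 2 * (A * Complex.cos θ + B) * Complex.cos θ +
      (A * Complex.cos θ + B) ^ 2) * Complex.sin θ)
    (q := fun n y => (p n).eval (Complex.cos y)) (z := θ) j₀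
    (by intro j; fin_cases j <;> simp only [trigCoeff] <;> simp <;> fun_prop)
    (by intro j; fin_cases j <;> simp only [trigBase] <;> simp <;> fun_prop)
    (by fun_prop) (fun n => (hq n).differentiableAt)
    (fun n y => by
      rw [← mul_aeval_chebComb_cos_eq_sum, hp, eval_map_algebraMap])
    hdom hα0 hh0 (mul_ne_zero hK hsin)
  refine (hlim.div_const (-Complex.sin θ)).congr fun n => ?_
  rw [(hq n).deriv]
  have : -Complex.sin θ ≠ 0 := neg_ne_zero.2 hsin
  simp only [hp]
  field_simp

/-- The open half-strip which `cos` maps to the lower half-plane. -/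
def halfStrip : Set ℂ := Set.Ioo 0 Real.pi ×ℂ Set.Ioi 0

theorem cos_im_neg_of_mem_halfStrip {θ : ℂ} (h : θ ∈ halfStrip) : (Complex.cos θ).im < 0 := by
  obtain ⟨h1, h2⟩ := h
  have h3 := Real.sin_pos_of_pos_of_lt_pi h1.1 h1.2
  have h4 : 0 < Real.sinh θ.im := Real.sinh_pos_iff.2 h2
  rw [Complex.cos_eq, ← Complex.ofReal_cos, ← Complex.ofReal_cosh, ← Complex.ofReal_sin,
    ← Complex.ofReal_sinh]
  simp only [Complex.sub_im, Complex.mul_im, Complex.ofReal_im, Complex.ofReal_re, Complex.I_im,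
    Complex.I_re, Complex.mul_re]
  nlinarith [mul_pos h3 h4]

theorem sin_ne_zero_of_mem_halfStrip {θ : ℂ} (h : θ ∈ halfStrip) : Complex.sin θ ≠ 0 := by
  rw [Complex.sin_ne_zero_iff]
  rintro k rfl
  have := h.2
  simp at this

/-- Every `v` in the upper half of the unit disc is `e^{iθ}` for some `θ` in the half-strip. -/
theorem exists_halfStrip_exp_eq {v : ℂ} (hv : 0 < v.im) (hv1 : ‖v‖ < 1) :
    ∃ θ ∈ halfStrip, Complex.exp (Complex.I * θ) = v := by
  have hv0 : v ≠ 0 := fun h => by simp [h] at hv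
  refine ⟨-Complex.I * Complex.log v, ⟨?_, ?_⟩, ?_⟩
  · have h1 : (-Complex.I * Complex.log v).re = v.arg := by simp [Complex.log_im]
    simp only [Set.mem_preimage, h1]
    refine ⟨lt_of_le_of_ne (Complex.arg_nonneg_iff.2 hv.le) fun h => ?_,
      lt_of_le_of_ne (Complex.arg_le_pi v) fun h => ?_⟩
    · exact hv.ne' (Complex.arg_eq_zero_iff.1 h.symm).2
    · exact hv.ne' (Complex.arg_eq_pi_iff.1 h).2
  · have h1 : (-Complex.I * Complex.log v).im = -Real.log ‖v‖ := by simp [Complex.log_re]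
    simp only [Set.mem_preimage, h1, Set.mem_Ioi, neg_pos]
    exact Real.log_neg (norm_pos_iff.2 hv0) hv1
  · rw [← mul_assoc, mul_neg, Complex.I_mul_I, neg_neg, one_mul, Complex.exp_log hv0]

/-- `cos` maps the half-strip onto the lower half-plane. -/
theorem exists_halfStrip_cos_eq {x : ℂ} (hx : x.im < 0) : ∃ θ ∈ halfStrip, Complex.cos θ = x := by
  obtain ⟨θ₀, rfl⟩ := Complex.cos_surjective x
  have key : ∀ θ₁ : ℂ, 0 < θ₁.im → (Complex.cos θ₁).im < 0 →
      ∃ θ ∈ halfStrip, Complex.cos θ = Complex.cos θ₁ := by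
    intro θ₁ h1 h2
    set v := Complex.exp (Complex.I * θ₁) with hv
    have hnorm : ‖v‖ < 1 := by
      rw [hv, norm_exp_I_mul]
      exact Real.exp_lt_one_iff.2 (by linarith)
    have hv0 : 0 < ‖v‖ := norm_pos_iff.2 (Complex.exp_ne_zero _)
    have hinv : Complex.exp (-(Complex.I * θ₁)) = v⁻¹ := by rw [Complex.exp_neg]
    have hsum := congrArg Complex.im (exp_add_exp_neg θ₁)
    rw [hinv, ← hv, Complex.add_im, Complex.inv_im, Complex.normSq_eq_norm_sq] at hsum
    have hIm : (2 * Complex.cos θ₁).im = 2 * (Complex.cos θ₁).im := by simp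
    rw [hIm] at hsum
    have hvim : 0 < v.im := by
      by_contra hle
      push Not at hle
      have h3 : v.im * ‖v‖ ^ 2 - v.im = ‖v‖ ^ 2 * (2 * (Complex.cos θ₁).im) := by
        rw [← hsum]
        field_simp
        ring
      have h4 : ‖v‖ ^ 2 < 1 := pow_lt_one₀ hv0.le hnorm two_ne_zero
      have h5 : 0 < ‖v‖ ^ 2 := by positivity
      nlinarith [mul_pos h5 (neg_pos.2 h2)]
    obtain ⟨θ, hθ, hθv⟩ := exists_halfStrip_exp_eq hvim hnorm
    refine ⟨θ, hθ, ?_⟩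
    have h6 := exp_add_exp_neg θ
    have h7 := exp_add_exp_neg θ₁
    rw [Complex.exp_neg, hθv] at h6
    rw [hinv, ← hv, h6] at h7
    exact mul_left_cancel₀ two_ne_zero h7
  rcases lt_trichotomy θ₀.im 0 with h | h | h
  · have := key (-θ₀) (by simpa using h) (by rwa [Complex.cos_neg])
    rwa [Complex.cos_neg] at this
  · have hreal : (θ₀.re : ℂ) = θ₀ := Complex.ext rfl (by simp [h])
    rw [← hreal, Complex.cos_ofReal_im] at hx
    exact absurd hx (lt_irrefl _)
  · exact key θ₀ h hx

theorem quadratic_eq_mul (s θ : ℂ) : 1 - 2 * s * Complex.cos θ + s ^ 2 =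
    (s - Complex.exp (Complex.I * θ)) * (s - Complex.exp (-(Complex.I * θ))) := by
  linear_combination s * exp_add_exp_neg θ - exp_mul_exp_neg θ

/-- Where `|s| > |e^{-iθ}|`, the limit of `Q_n' / (n Q_n)` at `cos θ` is the logarithmic derivative
of `s = A x + B`. -/
theorem tendsto_logDeriv_of_linear_dominant {A B : ℝ} {θ : ℂ} (hθ : θ ∈ halfStrip)
    (hs : ‖Complex.exp (-(Complex.I * θ))‖ < ‖A * Complex.cos θ + B‖) :
    Filter.Tendsto (fun n : ℕ =>
      ((chebComb A B n).map (algebraMap ℝ ℂ)).derivative.eval (Complex.cos θ) /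
        (n * ((chebComb A B n).map (algebraMap ℝ ℂ)).eval (Complex.cos θ))) Filter.atTop
      (nhds (A / (A * Complex.cos θ + B))) := by
  have him : 0 < θ.im := hθ.2
  have hsin := sin_ne_zero_of_mem_halfStrip hθ
  have hvw : ‖Complex.exp (Complex.I * θ)‖ < ‖A * Complex.cos θ + B‖ := by
    refine lt_trans ?_ hs
    rw [norm_exp_I_mul, norm_exp_neg_I_mul, Real.exp_lt_exp]
    linarith
  have hs0 : (A * Complex.cos θ + B : ℂ) ≠ 0 := norm_pos_iff.1 ((norm_nonneg _).trans_lt hs)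
  have hlim := tendsto_logDeriv_chebComb (A := A) (B := B) (θ := θ) 2
    (by
      intro j hj
      fin_cases j
      · exact hvw
      · exact hs
      · exact absurd rfl hj)
    (mul_ne_zero (pow_ne_zero 2 hs0) hsin) hs0
    (by
      rw [quadratic_eq_mul]
      refine mul_ne_zero (sub_ne_zero.2 fun h => ?_) (sub_ne_zero.2 fun h => ?_)
      · rw [h] at hvw
        exact lt_irrefl _ hvw
      · rw [h] at hs
        exact lt_irrefl _ hs)
    hsin
  have hder : deriv (trigBase A B 2) θ = -(A * Complex.sin θ) := by
    have h : HasDerivAt (trigBase A B 2) (A * -Complex.sin θ) θ :=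
      ((Complex.hasDerivAt_cos θ).const_mul (A : ℂ)).add_const (B : ℂ)
    rw [h.deriv, mul_neg]
  have hval : trigBase A B 2 θ = A * Complex.cos θ + B := rfl
  rw [hder, hval] at hlim
  convert hlim using 2
  field_simp

/-- Where `|s| < |e^{-iθ}|`, the limit of `Q_n' / (n Q_n)` at `cos θ` is `i / sin θ`, the
logarithmic derivative of `e^{-iθ}` with respect to `cos θ`. -/
theorem tendsto_logDeriv_of_exp_dominant {A B : ℝ} {θ : ℂ} (hθ : θ ∈ halfStrip)
    (hs : ‖A * Complex.cos θ + B‖ < ‖Complex.exp (-(Complex.I * θ))‖)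
    (hs1 : (A * Complex.cos θ + B) * Complex.exp (-(Complex.I * θ)) ≠ 1) :
    Filter.Tendsto (fun n : ℕ =>
      ((chebComb A B n).map (algebraMap ℝ ℂ)).derivative.eval (Complex.cos θ) /
        (n * ((chebComb A B n).map (algebraMap ℝ ℂ)).eval (Complex.cos θ))) Filter.atTop
      (nhds (Complex.I / Complex.sin θ)) := by
  have him : 0 < θ.im := hθ.2
  have hsin := sin_ne_zero_of_mem_halfStrip hθ
  have hw0 := Complex.exp_ne_zero (-(Complex.I * θ))
  have hlim := tendsto_logDeriv_chebComb (A := A) (B := B) (θ := θ) 1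
    (by
      intro j hj
      fin_cases j
      · change ‖Complex.exp (Complex.I * θ)‖ < ‖Complex.exp (-(Complex.I * θ))‖
        rw [norm_exp_I_mul, norm_exp_neg_I_mul, Real.exp_lt_exp]
        linarith
      · exact absurd rfl hj
      · exact hs)
    (by
      refine div_ne_zero (neg_ne_zero.2 ?_) (mul_ne_zero two_ne_zero Complex.I_ne_zero)
      rw [show ∀ s w : ℂ, w - s * w ^ 2 = w * (1 - s * w) by intros; ring]
      exact mul_ne_zero hw0 (sub_ne_zero.2 hs1.symm))
    hw0
    (by
      rw [quadratic_eq_mul]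
      refine mul_ne_zero (sub_ne_zero.2 fun h => ?_) (sub_ne_zero.2 fun h => ?_)
      · rw [h] at hs1
        exact hs1 (exp_mul_exp_neg θ)
      · rw [h] at hs
        exact lt_irrefl _ hs)
    hsin
  have hder : deriv (trigBase A B 1) θ = trigBase A B 1 θ * -Complex.I := by
    have h : HasDerivAt (trigBase A B 1) (Complex.exp (-(Complex.I * θ)) * -(Complex.I * 1)) θ :=
      (((hasDerivAt_id θ).const_mul Complex.I).neg).cexp
    rw [h.deriv, mul_one]
    rfl
  rw [hder, mul_div_cancel_left₀ _ (show trigBase A B 1 θ ≠ 0 from hw0), neg_div_neg_eq] at hlim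
  exact hlim

theorem isOpen_halfStrip : IsOpen halfStrip := isOpen_Ioo.reProdIm isOpen_Ioi

theorem isPreconnected_halfStrip : IsPreconnected halfStrip :=
  (((convex_Ioo 0 Real.pi).linear_preimage Complex.reLm).inter
    ((convex_Ioi 0).linear_preimage Complex.imLm)).isPreconnected

/-- If `|A| + |B| > 1`, then `|A x + B| > 1` at `x = 1` or at `x = -1`, which are the images under
`cos` of the corners of the half-strip; hence `A cos θ + B` dominates `e^{-iθ}` somewhere in the
half-strip. -/
theorem exists_linear_dominant {A B : ℝ} (h : 1 < |A| + |B|) :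
    ∃ θ ∈ halfStrip, ‖Complex.exp (-(Complex.I * θ))‖ < ‖A * Complex.cos θ + B‖ := by
  have hopen : IsOpen {θ : ℂ | ‖Complex.exp (-(Complex.I * θ))‖ < ‖A * Complex.cos θ + B‖} :=
    isOpen_lt (by fun_prop) (by fun_prop)
  have hclosure : ∀ t ∈ Set.Icc 0 Real.pi, (t : ℂ) ∈ closure halfStrip := by
    intro t ht
    rw [halfStrip, Complex.closure_reProdIm, closure_Ioo Real.pi_pos.ne, closure_Ioi]
    exact ⟨by simpa using ht, by simp⟩
  have hcorner : ∃ t ∈ Set.Icc 0 Real.pi, 1 < |A * Real.cos t + B| := by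
    by_contra hcon
    push Not at hcon
    have h0 := hcon 0 ⟨le_rfl, Real.pi_pos.le⟩
    have h1 := hcon Real.pi ⟨Real.pi_pos.le, le_rfl⟩
    rw [Real.cos_zero, abs_le] at h0
    rw [Real.cos_pi, abs_le] at h1
    rcases abs_cases A with hA | hA <;> rcases abs_cases B with hB | hB <;> linarith
  obtain ⟨t, ht, hlt⟩ := hcorner
  have hmem : (t : ℂ) ∈ {θ : ℂ | ‖Complex.exp (-(Complex.I * θ))‖ < ‖A * Complex.cos θ + B‖} := by
    change ‖Complex.exp (-(Complex.I * t))‖ < ‖A * Complex.cos t + B‖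
    rw [norm_exp_neg_I_mul, Complex.ofReal_im, Real.exp_zero, ← Complex.ofReal_cos,
      ← Complex.ofReal_mul, ← Complex.ofReal_add, Complex.norm_real]
    exact hlt
  obtain ⟨θ, h1, h2⟩ := mem_closure_iff.1 (hclosure t ht) _ hopen hmem
  exact ⟨θ, h2, h1⟩

/-- The exponential `e^{-iθ}` dominates `A cos θ + B` somewhere in the half-strip: near the zero of
`A x + B` if `A ≠ 0`, and far from the real axis if `A = 0`. -/
theorem exists_exp_dominant (A B : ℝ) :
    ∃ θ ∈ halfStrip, ‖A * Complex.cos θ + B‖ < ‖Complex.exp (-(Complex.I * θ))‖ ∧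
      (A * Complex.cos θ + B) * Complex.exp (-(Complex.I * θ)) ≠ 1 := by
  rcases eq_or_ne A 0 with rfl | hA
  · set r : ℝ := |B| + 2 with hr
    have hr0 : 0 < r := by positivity
    obtain ⟨θ, hθ, hv⟩ := exists_halfStrip_exp_eq (v := (r⁻¹ : ℝ) * Complex.I)
      (by simpa using hr0) (by
        rw [norm_mul, Complex.norm_I, mul_one, Complex.norm_real,
          Real.norm_of_nonneg (by positivity)]
        exact inv_lt_one_of_one_lt₀ (by linarith [abs_nonneg B]))
    have hw : Complex.exp (-(Complex.I * θ)) = -(r * Complex.I) := by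
      rw [Complex.exp_neg, hv, mul_inv, Complex.inv_I]
      simp
    refine ⟨θ, hθ, ?_, fun h => ?_⟩
    · rw [hw, norm_neg, norm_mul, Complex.norm_I, mul_one, Complex.norm_real,
        Real.norm_of_nonneg hr0.le]
      simp only [Complex.ofReal_zero, zero_mul, zero_add, Complex.norm_real, Real.norm_eq_abs]
      linarith
    · have := congrArg Complex.re h
      simp [hw] at this
  · -- At `x = -B/A - iε` one has `|s| = |A| ε`, while `|e^{-iθ}| ≤ 2 |x| + 1` stays bounded.
    set M : ℝ := 2 * (|B / A| + 1) + 1 with hM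
    have hM0 : 0 < M := by positivity
    have hA0 := abs_pos.2 hA
    set ε : ℝ := min 1 (1 / (2 * |A| * M)) with hε
    have hε0 : 0 < ε := by positivity
    have hε1 : ε ≤ 1 := min_le_left _ _
    have hε2 : |A| * ε * M ≤ 1 / 2 := by
      have := min_le_right 1 (1 / (2 * |A| * M))
      rw [← hε, le_div_iff₀ (by positivity)] at this
      linarith
    set x : ℂ := -((B / A : ℝ) : ℂ) - ε * Complex.I with hx
    obtain ⟨θ, hθ, hcos⟩ := exists_halfStrip_cos_eq (x := x) (by simpa [hx] using hε0)
    have him : 0 < θ.im := hθ.2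
    have hs : A * Complex.cos θ + B = -(A * ε * Complex.I) := by
      have hAc : (A : ℂ) ≠ 0 := Complex.ofReal_ne_zero.2 hA
      rw [hcos, hx]
      push_cast
      field_simp
      ring
    have hsn : ‖A * Complex.cos θ + B‖ = |A| * ε := by
      rw [hs, norm_neg, norm_mul, norm_mul, Complex.norm_I, mul_one, Complex.norm_real,
        Complex.norm_real, Real.norm_eq_abs, Real.norm_of_nonneg hε0.le]
    have hxn : ‖x‖ ≤ |B / A| + 1 := by
      refine (norm_sub_le _ _).trans ?_
      rw [norm_neg, norm_mul, Complex.norm_I, mul_one, Complex.norm_real, Complex.norm_real,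
        Real.norm_eq_abs, Real.norm_of_nonneg hε0.le]
      linarith
    have hv1 : ‖Complex.exp (Complex.I * θ)‖ ≤ 1 := by
      rw [norm_exp_I_mul]
      exact Real.exp_le_one_iff.2 (by linarith)
    have hw1 : 1 < ‖Complex.exp (-(Complex.I * θ))‖ := by
      rw [norm_exp_neg_I_mul]
      exact Real.one_lt_exp_iff.2 him
    have hwM : ‖Complex.exp (-(Complex.I * θ))‖ ≤ M := by
      have h1 : Complex.exp (-(Complex.I * θ)) = 2 * x - Complex.exp (Complex.I * θ) := by
        rw [← hcos, ← exp_add_exp_neg]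
        ring
      rw [h1]
      refine (norm_sub_le _ _).trans ?_
      rw [norm_mul, Complex.norm_two]
      linarith
    have hprod : ‖A * Complex.cos θ + B‖ * ‖Complex.exp (-(Complex.I * θ))‖ ≤ 1 / 2 := by
      rw [hsn]
      refine le_trans ?_ hε2
      gcongr
    refine ⟨θ, hθ, by nlinarith [norm_nonneg (A * Complex.cos θ + B)], fun h => ?_⟩
    rw [← norm_mul, h, norm_one] at hprod
    norm_num at hprod

/-- If all zeros of all `Q_n` are real, then `|A| + |B| ≤ 1`: otherwise the limit function `g` of
`Q_n' / (n Q_n)` would be equal to `A / (A x + B)` on the whole lower half-plane by analytic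
continuation, against its value where `e^{-iθ}` dominates. -/
theorem abs_add_abs_le_one_of_real_zeros {A B : ℝ}
    (h : ∀ n, ∀ z ∈ (chebComb A B n).rootSet ℂ, z.im = 0) : |A| + |B| ≤ 1 := by
  by_contra! hAB
  obtain ⟨g, hgdiff, hglim⟩ := exists_limit_logDeriv
    (fun n => (chebComb A B n).map (algebraMap ℝ ℂ))
    (fun n => natDegree_map_le.trans (natDegree_chebComb_le A B n))
    (fun n r hr => h n r (mem_rootSet.2 (mem_aroots.1 hr)))
  obtain ⟨θ₁, hθ₁, hdom₁⟩ := exists_linear_dominant hAB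
  obtain ⟨θ₂, hθ₂, hdom₂, hne₂⟩ := exists_exp_dominant A B
  have hopen : IsOpen {θ : ℂ | ‖Complex.exp (-(Complex.I * θ))‖ < ‖A * Complex.cos θ + B‖} :=
    isOpen_lt (by fun_prop) (by fun_prop)
  have hdiff : DifferentiableOn ℂ (fun θ => g (Complex.cos θ) * (A * Complex.cos θ + B))
      halfStrip := by
    intro θ hθ
    refine DifferentiableAt.differentiableWithinAt (DifferentiableAt.mul ?_ (by fun_prop))
    exact (hgdiff _ (cos_im_neg_of_mem_halfStrip hθ)).comp θ
      Complex.differentiable_cos.differentiableAt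
  have hcont := (hdiff.analyticOnNhd isOpen_halfStrip).eqOn_of_preconnected_of_eventuallyEq
    (g := fun _ => (A : ℂ)) analyticOnNhd_const isPreconnected_halfStrip hθ₁ (by
      filter_upwards [(hopen.inter isOpen_halfStrip).mem_nhds ⟨hdom₁, hθ₁⟩] with θ hθ
      have hs0 : (A * Complex.cos θ + B : ℂ) ≠ 0 :=
        norm_pos_iff.1 ((norm_nonneg _).trans_lt hθ.1)
      rw [hglim _ (cos_im_neg_of_mem_halfStrip hθ.2) _
        (tendsto_logDeriv_of_linear_dominant hθ.2 hθ.1), div_mul_cancel₀ _ hs0])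
  have h2 := hcont hθ₂
  simp only at h2
  rw [hglim _ (cos_im_neg_of_mem_halfStrip hθ₂) _
    (tendsto_logDeriv_of_exp_dominant hθ₂ hdom₂ hne₂)] at h2
  have hsin := sin_ne_zero_of_mem_halfStrip hθ₂
  have h3 : A * Complex.exp (Complex.I * θ₂) = -B := by
    rw [mul_comm Complex.I, Complex.exp_mul_I]
    have h4 : Complex.I * (A * Complex.cos θ₂ + B) = A * Complex.sin θ₂ := by
      rwa [div_mul_eq_mul_div, div_eq_iff hsin] at h2
    linear_combination -Complex.I * h4 + (A * Complex.cos θ₂ + B) * Complex.I_mul_I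
  have hre : θ₂.re ∈ Set.Ioo 0 Real.pi := hθ₂.1
  have hexpim : 0 < (Complex.exp (Complex.I * θ₂)).im := by
    rw [Complex.exp_im]
    simpa using mul_pos (Real.exp_pos _) (Real.sin_pos_of_pos_of_lt_pi hre.1 hre.2)
  have hA : A = 0 := by
    have h5 := congrArg Complex.im h3
    rw [Complex.im_ofReal_mul, Complex.neg_im, Complex.ofReal_im, neg_zero] at h5
    exact (mul_eq_zero.1 h5).resolve_right hexpim.ne'
  have hB : B = 0 := by simpa [hA] using h3
  rw [hA, hB] at hAB
  norm_num at hAB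

/-! ### Zeros of `P_n` -/

theorem genPoly_eq_zero_iff (a b : ℝ) (n : ℕ) :
    genPoly a b n = 0 ↔ chebComb (2 * a) (-b) n = 0 := by
  rw [genPoly_eq_chebComb_comp]
  refine comp_eq_zero_iff.trans (or_iff_left fun h => ?_)
  have := congrArg (coeff · 1) h.2
  simp at this

theorem aeval_genPoly (a b : ℝ) (n : ℕ) (z : ℂ) :
    aeval z (genPoly a b n) = aeval (-z / 2) (chebComb (2 * a) (-b) n) := by
  have h : aeval z (C (-(1 / 2) : ℝ) * X) = -z / 2 := by
    simp
    ring
  rw [genPoly_eq_chebComb_comp, aeval_comp, h]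

theorem eval_genPoly (a b : ℝ) (n : ℕ) (x : ℝ) :
    (genPoly a b n).eval x = (chebComb (2 * a) (-b) n).eval (-x / 2) := by
  rw [genPoly_eq_chebComb_comp, eval_comp]
  congr 1
  simp
  ring

theorem mem_rootSet_genPoly {a b : ℝ} {n : ℕ} {z : ℂ} :
    z ∈ (genPoly a b n).rootSet ℂ ↔ -z / 2 ∈ (chebComb (2 * a) (-b) n).rootSet ℂ := by
  rw [mem_rootSet, mem_rootSet, aeval_genPoly, Ne, genPoly_eq_zero_iff]

theorem theorem3 (a b : ℝ) :
    (∀ n : ℕ, genPoly a b n = (chebComb (2 * a) (-b) n).comp (C (-(1 / 2) : ℝ) * X)) ∧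
    ((∀ n : ℕ, ∀ z ∈ (genPoly a b n).rootSet ℂ, z.im = 0) ↔ |b| ≤ 1 - 2 * |a|) ∧
    (|b| ≤ 1 - 2 * |a| →
      (∀ n : ℕ, genPoly a b n ≠ 0 ∧
        ∀ z ∈ (genPoly a b n).rootSet ℂ, ∃ x : ℝ, x ∈ Set.Ioo (-2 : ℝ) 2 ∧ (x : ℂ) = z) ∧
      (∀ u v : ℝ, -2 ≤ u → u < v → v ≤ 2 →
        ∀ᶠ n : ℕ in Filter.atTop, ∃ x ∈ Set.Ioo u v, (genPoly a b n).IsRoot x)) := by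
  have hparam : |b| ≤ 1 - 2 * |a| ↔ |2 * a| + |-b| ≤ 1 := by
    rw [abs_neg, abs_mul, abs_two]
    constructor <;> intro h <;> linarith
  have hzeros : |2 * a| + |-b| ≤ 1 → ∀ n, ∀ z ∈ (genPoly a b n).rootSet ℂ,
      ∃ x : ℝ, x ∈ Set.Ioo (-2 : ℝ) 2 ∧ (x : ℂ) = z := by
    intro h n z hz
    obtain ⟨x, hx, hxz⟩ :=
      exists_eq_ofReal_of_mem_rootSet_chebComb h n (mem_rootSet_genPoly.1 hz)
    refine ⟨-2 * x, ⟨by linarith [hx.2], by linarith [hx.1]⟩, ?_⟩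
    push_cast
    rw [hxz]
    ring
  rw [hparam]
  refine ⟨genPoly_eq_chebComb_comp a b, ⟨fun h => ?_, fun h n z hz => ?_⟩, fun h =>
    ⟨fun n => ⟨?_, hzeros h n⟩, fun u v hu huv hv => ?_⟩⟩
  · refine abs_add_abs_le_one_of_real_zeros fun n z hz => ?_
    have := h n (-2 * z) (mem_rootSet_genPoly.2 (by rwa [show -(-2 * z) / 2 = z by ring]))
    simpa using this
  · obtain ⟨x, -, rfl⟩ := hzeros h n z hz
    exact Complex.ofReal_im x
  · rw [Ne, genPoly_eq_zero_iff]
    exact chebComb_ne_zero h n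
  · have hlt : Real.arccos (-u / 2) < Real.arccos (-v / 2) :=
      Real.strictAntiOn_arccos ⟨by linarith, by linarith⟩ ⟨by linarith, by linarith⟩ (by linarith)
    filter_upwards [eventually_exists_zero h (Real.arccos_nonneg _) hlt (Real.arccos_le_pi _)]
      with n ⟨θ, hθ, hzero⟩
    have hθ0 : 0 ≤ θ := (Real.arccos_nonneg _).trans hθ.1.le
    have hθπ : θ ≤ Real.pi := hθ.2.le.trans (Real.arccos_le_pi _)
    have h1 := Real.strictAntiOn_cos ⟨Real.arccos_nonneg _, Real.arccos_le_pi _⟩ ⟨hθ0, hθπ⟩ hθ.1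
    have h2 := Real.strictAntiOn_cos ⟨hθ0, hθπ⟩ ⟨Real.arccos_nonneg _, Real.arccos_le_pi _⟩ hθ.2
    rw [Real.cos_arccos (by linarith) (by linarith)] at h1 h2
    refine ⟨-2 * Real.cos θ, ⟨by linarith, by linarith⟩, ?_⟩
    rw [IsRoot.def, eval_genPoly, show -(-2 * Real.cos θ) / 2 = Real.cos θ by ring, hzero]
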